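/- For a prime $p$ and nonzero integers $x=\bar x p^{\alpha}$, $y=\bar y p^{\beta}$ with $p\nmid\bar x\bar y$, let $(x,y)_p$ be the Hilbert symbol $$(x,y)_p=\Big(\tfrac{-1}{p}\Big)^{\alpha\beta}\Big(\tfrac{\bar x}{p}\Big)^{\beta}\Big(\tfrac{\bar y}{p}\Big)^{\alpha}\ (p>2),\qquad (x,y)_2=(-1)^{(\bar x-1)(\bar y-1)/4+\alpha(\bar y^2-1)/8+\beta(\bar x^2-1)/8},$$ and let $(x,y)_\infty=-1$ if $x<0$ and $y<0$, and $(x,y)_\infty=1$ otherwise. Extend these symbols to nonzero rationals by $(xs^2,yt^2)_p=(x,y)_p$ for nonzero rationals $s,t$. Call a rational $n\times n$ matrix $X$ nondegenerate if for each $i\in\{1,\dots,n\}$ the submatrix $X_i$ formed by its first $i$ rows and columns is invertible; its Hasse--Minkowski invariant at $p$ is then $$C_p(X)=(-1,-|X_n|)_p\prod_{i=1}^{n-1}(|X_i|,-|X_{i+1}|)_p ,$$ where $|\cdot|$ denotes the determinant. Let $B_2(a)=\begin{pmatrix}a&2\\2&a\end{pmatrix}$ and, for $n\ge 3$, let $B_n(a)$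 be the $n\times n$ matrix with diagonal entries $a$, entries $1$ in the positions $(i,j)$ with $i-j\equiv\pm1\pmod n$, and entries $0$ elsewhere. Let $g_1(a)=1$, $g_2(a)=a$ and $g_n(a)=a\,g_{n-1}(a)-g_{n-2}(a)$ for $n\ge 3$. Let $n$ and $a$ be integers with $a>2$ and $n\ge 2$, and let $p$ be a prime or $p=\infty$. Then $B_n(a)$ is nondegenerate and $$C_p(B_n(a))=\big(-(a+2)(a-2)^{n+1},\,-g_n(a)\big)_p\ \prod_{i=2}^{n}\big(-g_i(a),\,g_{i-1}(a)\big)_p .$$ -/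

import Mathlib

open scoped BigOperators

/-- A place of `ℚ`: a prime `p`, or `∞`. -/
inductive RatPlace : Type
  | finite (p : Nat.Primes) : RatPlace
  | infinite : RatPlace

/-- The exponent `α` in the `p`-factorisation `a = ā * p ^ α` of a nonzero integer `a`. -/
def pExponent (p : Nat.Primes) (a : ℤ) : ℕ := padicValInt (p : ℕ) a

/-- The part `ā` prime to `p` in the `p`-factorisation `a = ā * p ^ α` of a nonzero integer `a`
(the division is exact, and `ā` carries the sign of `a`). -/
def pFreePart (p : Nat.Primes) (a : ℤ) : ℤ := a / (p : ℤ) ^ pExponent p a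

/-- The Hilbert symbol `(a, b)_p` of nonzero integers at a prime `p`. The first formula is the one
for `p = 2` (there all the divisions are exact), the second one is for odd `p`. -/
def hilbertSymbolPrime (p : Nat.Primes) (a b : ℤ) : ℤ :=
  haveI : Fact (p : ℕ).Prime := ⟨p.2⟩
  if (p : ℕ) = 2 then
    ((Int.negOnePow ((pFreePart p a - 1) * (pFreePart p b - 1) / 4
        + (pExponent p a : ℤ) * ((pFreePart p b ^ 2 - 1) / 8)
        + (pExponent p b : ℤ) * ((pFreePart p a ^ 2 - 1) / 8)) : ℤˣ) : ℤ)
  else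
    legendreSym (p : ℕ) (-1) ^ (pExponent p a * pExponent p b)
      * legendreSym (p : ℕ) (pFreePart p a) ^ pExponent p b
      * legendreSym (p : ℕ) (pFreePart p b) ^ pExponent p a

/-- The Hilbert symbol `(a, b)_v` of nonzero integers at a prime or at `∞`. -/
def hilbertSymbol : RatPlace → ℤ → ℤ → ℤ
  | RatPlace.finite p, a, b => hilbertSymbolPrime p a b
  | RatPlace.infinite, a, b => if a < 0 ∧ b < 0 then -1 else 1

/-- The Hilbert symbol of nonzero rationals. It depends only on the classes of `x` and `y` modulo
nonzero rational squares, and `x = num / den` is in the class of the integer `num * den`. -/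
def hilbertSymbolRat (v : RatPlace) (x y : ℚ) : ℤ :=
  hilbertSymbol v (x.num * (x.den : ℤ)) (y.num * (y.den : ℤ))

theorem hilbertSymbolRat_intCast (v : RatPlace) (a b : ℤ) :
    hilbertSymbolRat v (a : ℚ) (b : ℚ) = hilbertSymbol v a b := by
  simp [hilbertSymbolRat]

/-- The determinant of the `i × i` submatrix in the first `i` rows and columns, for `i ≤ n`. -/
def leadingMinor {n : ℕ} (X : Matrix (Fin n) (Fin n) ℚ) (i : ℕ) (hi : i ≤ n) : ℚ :=
  (X.submatrix (Fin.castLE hi) (Fin.castLE hi)).det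

/-- All the leading principal submatrices of `X` are invertible. -/
def IsNondegenerateMatrix {n : ℕ} (X : Matrix (Fin n) (Fin n) ℚ) : Prop :=
  ∀ (i : ℕ) (hi : i ≤ n), 1 ≤ i → leadingMinor X i hi ≠ 0

/-- The Hasse-Minkowski invariant
`C_v(X) = (-1, -|X_n|)_v * ∏_{i=1}^{n-1} (|X_i|, -|X_{i+1}|)_v` of a nondegenerate rational
`n × n` matrix `X`; the factor of index `i : Fin (n - 1)` below is the one for `i + 1`. -/
def hasseMinkowski (v : RatPlace) {n : ℕ} (X : Matrix (Fin n) (Fin n) ℚ) : ℤ :=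
  hilbertSymbolRat v (-1) (-X.det)
    * ∏ i : Fin (n - 1),
        hilbertSymbolRat v (leadingMinor X ((i : ℕ) + 1) (by omega))
          (-leadingMinor X ((i : ℕ) + 2) (by omega))

/-- The matrix `B_n(a)`, for `n ≥ 2`: `B_2(a)` has rows `(a, 2)` and `(2, a)`; for `n ≥ 3` it has
`a` on the diagonal, `1` at the pairs of cyclically consecutive indices, and `0` elsewhere. -/
def cycleMatrix (n : ℕ) (a : ℤ) : Matrix (Fin n) (Fin n) ℚ :=
  Matrix.of fun i j =>
    if i = j then (a : ℚ)
    else if n = 2 then 2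
    else if (i : ℕ) + 1 = j ∨ (j : ℕ) + 1 = i ∨ ((i : ℕ) = 0 ∧ (j : ℕ) + 1 = n)
        ∨ ((j : ℕ) = 0 ∧ (i : ℕ) + 1 = n) then 1
    else 0

/-- The sequence `g_1(a) = 1`, `g_2(a) = a`, `g_n(a) = a * g_{n-1}(a) - g_{n-2}(a)` for `n ≥ 3`
(the value at index `0` is not used). -/
def gSeq (a : ℤ) : ℕ → ℤ
  | 0 => 0
  | 1 => 1
  | 2 => a
  | (n + 3) => a * gSeq a (n + 2) - gSeq a (n + 1)

/-! ### The Hilbert symbol -/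

/-! Cutting a cycle leaves a path, so the proper leading minors of `B_n(a)` are tridiagonal
determinants, equal to `g_{i+1}` (`leadingMinor_cycleMatrix`). The full determinant `D` is found by
a Cramer argument (`det_cycleMatrix`); duplication formulas for `g` show that it is
`(a+2)(a-2)^{n+1}` times a rational square. All these numbers are positive for `a > 2`, hence
nondegeneracy. Bilinearity of the symbol then merges `(-1,-D)(g_n,-D)` into `(-g_n,-D)`, and the
other factors match one by one. -/

theorem eq_pow_pExponent_mul_pFreePart (p : Nat.Primes) (a : ℤ) :
    a = (p : ℤ) ^ pExponent p a * pFreePart p a := by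
  have : Fact (p : ℕ).Prime := ⟨p.2⟩
  exact (Int.mul_ediv_cancel' (padicValInt_dvd (p := (p : ℕ)) a)).symm

theorem pExponent_mul (p : Nat.Primes) {a b : ℤ} (ha : a ≠ 0) (hb : b ≠ 0) :
    pExponent p (a * b) = pExponent p a + pExponent p b := by
  have : Fact (p : ℕ).Prime := ⟨p.2⟩
  exact padicValInt.mul ha hb

theorem pFreePart_mul (p : Nat.Primes) {a b : ℤ} (ha : a ≠ 0) (hb : b ≠ 0) :
    pFreePart p (a * b) = pFreePart p a * pFreePart p b := by
  have hp : ((p : ℕ) : ℤ) ≠ 0 := by exact_mod_cast p.2.ne_zero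
  have h := eq_pow_pExponent_mul_pFreePart p (a * b)
  rw [pExponent_mul p ha hb] at h
  apply mul_left_cancel₀ (pow_ne_zero (pExponent p a + pExponent p b) hp)
  rw [← h]
  conv_lhs => rw [eq_pow_pExponent_mul_pFreePart p a, eq_pow_pExponent_mul_pFreePart p b]
  ring

theorem not_dvd_pFreePart (p : Nat.Primes) {a : ℤ} (ha : a ≠ 0) :
    ¬ (p : ℤ) ∣ pFreePart p a := by
  have : Fact (p : ℕ).Prime := ⟨p.2⟩
  intro h
  have h1 : ((p : ℕ) : ℤ) ^ (pExponent p a + 1) ∣ a := by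
    conv_rhs => rw [eq_pow_pExponent_mul_pFreePart p a]
    rw [pow_succ]
    exact mul_dvd_mul_left _ h
  rcases (padicValInt_dvd_iff (p := (p : ℕ)) _ a).1 h1 with h2 | h2
  · exact ha h2
  · exact absurd h2 (by unfold pExponent; omega)

theorem hilbertSymbol_comm (v : RatPlace) (a b : ℤ) :
    hilbertSymbol v a b = hilbertSymbol v b a := by
  cases v with
  | infinite => simp only [hilbertSymbol, and_comm]
  | finite p =>
    simp only [hilbertSymbol, hilbertSymbolPrime]
    split_ifs with h
    · rw [mul_comm (pFreePart p a - 1), add_right_comm]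
    · rw [mul_comm (pExponent p a)]
      ring

theorem hilbertSymbol_mul_self (v : RatPlace) {a b : ℤ} (ha : a ≠ 0) (hb : b ≠ 0) :
    hilbertSymbol v a b * hilbertSymbol v a b = 1 := by
  cases v with
  | infinite => simp only [hilbertSymbol]; split_ifs <;> norm_num
  | finite p =>
    have : Fact (p : ℕ).Prime := ⟨p.2⟩
    simp only [hilbertSymbol, hilbertSymbolPrime]
    split_ifs with h
    · rw [← Units.val_mul, Int.units_mul_self, Units.val_one]
    · have key : ∀ {x : ℤ}, ¬ (p : ℤ) ∣ x → legendreSym (p : ℕ) x * legendreSym (p : ℕ) x = 1 := by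
        intro x hx
        rw [← sq]
        exact legendreSym.sq_one _ (by rwa [Ne, ZMod.intCast_zmod_eq_zero_iff_dvd])
      have h1 : ¬ (p : ℤ) ∣ -1 := by
        rw [dvd_neg]
        exact fun h => p.2.not_dvd_one (by exact_mod_cast h)
      rw [mul_mul_mul_comm, mul_mul_mul_comm (legendreSym _ _ ^ _), ← mul_pow, ← mul_pow,
        ← mul_pow, key h1, key (not_dvd_pFreePart p ha), key (not_dvd_pFreePart p hb)]
      simp

theorem hilbertSymbol_mul_left (v : RatPlace) {a b c : ℤ} (ha : a ≠ 0) (hb : b ≠ 0) (hc : c ≠ 0) :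
    hilbertSymbol v (a * b) c = hilbertSymbol v a c * hilbertSymbol v b c := by
  cases v with
  | infinite =>
    simp only [hilbertSymbol]
    rcases lt_or_gt_of_ne hc with h | h
    · rcases lt_or_gt_of_ne ha with h1 | h1 <;> rcases lt_or_gt_of_ne hb with h2 | h2
      · simp [h, h1, h2, (mul_pos_of_neg_of_neg h1 h2).not_gt]
      · simp [h, h1, h2.not_gt, mul_neg_of_neg_of_pos h1 h2]
      · simp [h, h1.not_gt, h2, mul_neg_of_pos_of_neg h1 h2]
      · simp [h, h1.not_gt, h2.not_gt, (mul_pos h1 h2).not_gt]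
    · simp [h.not_gt]
  | finite p =>
    have : Fact (p : ℕ).Prime := ⟨p.2⟩
    simp only [hilbertSymbol, hilbertSymbolPrime]
    rw [pExponent_mul p ha hb, pFreePart_mul p ha hb]
    split_ifs with h
    · have odd : ∀ {x : ℤ}, x ≠ 0 → ∃ k, pFreePart p x = 2 * k + 1 := by
        intro x hx
        have := not_dvd_pFreePart p hx
        rw [h] at this
        exact ⟨pFreePart p x / 2, by push_cast at this; omega⟩
      obtain ⟨i, hi⟩ := odd ha
      obtain ⟨j, hj⟩ := odd hb
      obtain ⟨k, hk⟩ := odd hc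
      obtain ⟨i', hi'⟩ := Int.even_mul_succ_self i
      obtain ⟨j', hj'⟩ := Int.even_mul_succ_self j
      have e1 : ∀ x y : ℤ, (2 * x + 1 - 1) * (2 * y + 1 - 1) / 4 = x * y := fun x y =>
        Int.ediv_eq_of_eq_mul_left (by norm_num) (by ring)
      have e2 : ((2 * i + 1) ^ 2 - 1) / 8 = i' :=
        Int.ediv_eq_of_eq_mul_left (by norm_num) (by linarith)
      have e3 : ((2 * j + 1) ^ 2 - 1) / 8 = j' :=
        Int.ediv_eq_of_eq_mul_left (by norm_num) (by linarith)
      have e4 : (((2 * i + 1) * (2 * j + 1)) ^ 2 - 1) / 8 = 8 * i' * j' + i' + j' := by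
        refine Int.ediv_eq_of_eq_mul_left (by norm_num) ?_
        have h1 : (2 * i + 1) ^ 2 = 8 * i' + 1 := by linarith
        have h2 : (2 * j + 1) ^ 2 = 8 * j' + 1 := by linarith
        rw [mul_pow, h1, h2]
        ring
      have e5 : (2 * i + 1) * (2 * j + 1) = 2 * (2 * i * j + i + j) + 1 := by ring
      rw [hi, hj, hk, e4, e5, e1, e1, e1, e2, e3, ← Units.val_mul, ← Int.negOnePow_add]
      congr 1
      rw [Int.negOnePow_eq_iff]
      push_cast
      -- Half the difference of the two exponents of `-1`, whose only discrepancies are `2ijk` and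
      -- `8i'j'` times the exponent of `c`.
      refine ⟨i * j * k + 4 * pExponent p c * i' * j', ?_⟩
      ring
    · rw [legendreSym.mul, add_mul, pow_add, pow_add, mul_pow]
      ring

theorem hilbertSymbol_mul_sq_left (v : RatPlace) {a b s : ℤ} (ha : a ≠ 0) (hb : b ≠ 0)
    (hs : s ≠ 0) : hilbertSymbol v (a * s ^ 2) b = hilbertSymbol v a b := by
  rw [hilbertSymbol_mul_left v ha (pow_ne_zero 2 hs) hb, sq, hilbertSymbol_mul_left v hs hs hb,
    hilbertSymbol_mul_self v hs hb, mul_one]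

/-! ### The sequence `g` -/

/-- The value `0` at index `0` continues the recurrence backwards. -/
theorem gSeq_add_two (a : ℤ) (n : ℕ) : gSeq a (n + 2) = a * gSeq a (n + 1) - gSeq a n := by
  cases n with
  | zero => simp [gSeq]
  | succ n => rfl

theorem gSeq_nonneg_and_lt {a : ℤ} (ha : 2 < a) (n : ℕ) :
    0 ≤ gSeq a n ∧ gSeq a n < gSeq a (n + 1) := by
  induction n with
  | zero => simp [gSeq]
  | succ n ih =>
    refine ⟨ih.1.trans ih.2.le, ?_⟩
    rw [gSeq_add_two]
    nlinarith

theorem gSeq_pos {a : ℤ} (ha : 2 < a) {n : ℕ} (hn : 1 ≤ n) : 0 < gSeq a n := by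
  obtain ⟨k, rfl⟩ := Nat.exists_eq_add_of_le' hn
  exact (gSeq_nonneg_and_lt ha k).1.trans_lt (gSeq_nonneg_and_lt ha k).2

/-- The recurrence preserves this quadratic form. -/
theorem gSeq_sq_add_sq (a : ℤ) (m : ℕ) :
    gSeq a (m + 1) ^ 2 - a * gSeq a m * gSeq a (m + 1) + gSeq a m ^ 2 = 1 := by
  induction m with
  | zero => simp [gSeq]
  | succ m ih => rw [gSeq_add_two]; linear_combination ih

theorem gSeq_two_mul (a : ℤ) (m : ℕ) :
    gSeq a (2 * m) = 2 * gSeq a m * gSeq a (m + 1) - a * gSeq a m ^ 2 ∧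
      gSeq a (2 * m + 1) = gSeq a (m + 1) ^ 2 - gSeq a m ^ 2 := by
  induction m with
  | zero => simp [gSeq]
  | succ m ih =>
    have h1 : gSeq a (2 * (m + 1)) = a * gSeq a (2 * m + 1) - gSeq a (2 * m) :=
      gSeq_add_two a (2 * m)
    have h2 : gSeq a (2 * (m + 1) + 1) = a * gSeq a (2 * (m + 1)) - gSeq a (2 * m + 1) :=
      gSeq_add_two a (2 * m + 1)
    rw [h2, h1, ih.1, ih.2, gSeq_add_two a m]
    constructor <;> ring

/-- The determinant of `B_{n+1}(a)`. -/
def cycleDet (a : ℤ) (n : ℕ) : ℤ := a * gSeq a (n + 1) - 2 * gSeq a n + 2 * (-1) ^ n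

/-- After duplication everything is quadratic in two consecutive terms, except the constant `2 *
(-1) ^ n`, which the invariant form of value `1` absorbs. -/
theorem cycleDet_odd (a : ℤ) (m : ℕ) :
    cycleDet a (2 * m + 1) = (a + 2) * (a - 2) * gSeq a (m + 1) ^ 2 := by
  have h := gSeq_two_mul a (m + 1)
  rw [cycleDet, show 2 * m + 1 + 1 = 2 * (m + 1) by ring, h.1, (gSeq_two_mul a m).2,
    gSeq_add_two]
  have := gSeq_sq_add_sq a m
  rw [pow_succ (-1 : ℤ), pow_mul]
  norm_num
  linear_combination 2 * this

theorem cycleDet_even (a : ℤ) (m : ℕ) :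
    cycleDet a (2 * m) = (a + 2) * (gSeq a (m + 1) - gSeq a m) ^ 2 := by
  have h := gSeq_two_mul a m
  rw [cycleDet, h.1, h.2, pow_mul]
  have := gSeq_sq_add_sq a m
  norm_num
  linear_combination -2 * this

theorem cycleDet_pos {a : ℤ} (ha : 2 < a) (n : ℕ) : 0 < cycleDet a n := by
  obtain ⟨m, rfl | rfl⟩ := Nat.even_or_odd' n
  · rw [cycleDet_even]
    have := (gSeq_nonneg_and_lt ha m).2
    exact mul_pos (by linarith) (pow_pos (by linarith) 2)
  · rw [cycleDet_odd]
    have := gSeq_pos ha (Nat.le_add_left 1 m)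
    exact mul_pos (mul_pos (by linarith) (by linarith)) (pow_pos this 2)

theorem hilbertSymbol_neg_cycleDet {a : ℤ} (ha : 2 < a) (v : RatPlace) (n : ℕ) {b : ℤ}
    (hb : b ≠ 0) : hilbertSymbol v (-cycleDet a n) b
      = hilbertSymbol v (-((a + 2) * (a - 2) ^ (n + 2))) b := by
  have h1 : a + 2 ≠ 0 := by linarith
  have h2 : a - 2 ≠ 0 := by linarith
  obtain ⟨m, rfl | rfl⟩ := Nat.even_or_odd' n
  · have h3 : gSeq a (m + 1) - gSeq a m ≠ 0 := by linarith [(gSeq_nonneg_and_lt ha m).2]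
    rw [cycleDet_even, ← neg_mul, hilbertSymbol_mul_sq_left v (neg_ne_zero.2 h1) hb h3,
      show -((a + 2) * (a - 2) ^ (2 * m + 2)) = -(a + 2) * ((a - 2) ^ (m + 1)) ^ 2 by ring,
      hilbertSymbol_mul_sq_left v (neg_ne_zero.2 h1) hb (pow_ne_zero _ h2)]
  · have h3 : gSeq a (m + 1) ≠ 0 := (gSeq_pos ha (Nat.le_add_left 1 m)).ne'
    have h4 : -((a + 2) * (a - 2)) ≠ 0 := neg_ne_zero.2 (mul_ne_zero h1 h2)
    rw [cycleDet_odd, ← neg_mul, hilbertSymbol_mul_sq_left v h4 hb h3,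
      show -((a + 2) * (a - 2) ^ (2 * m + 1 + 2))
        = -((a + 2) * (a - 2)) * ((a - 2) ^ (m + 1)) ^ 2 by ring,
      hilbertSymbol_mul_sq_left v h4 hb (pow_ne_zero _ h2)]

/-! ### Determinants -/

/-- Cramer's rule: apply the adjugate to both sides and read off the last coordinate. -/
theorem det_mul_last_of_mulVec_eq_single {R : Type*} [CommRing R] {m : ℕ}
    (A : Matrix (Fin (m + 1)) (Fin (m + 1)) R) (x : Fin (m + 1) → R) (δ : R)
    (h : A.mulVec x = Pi.single (Fin.last m) δ) :
    A.det * x (Fin.last m) = δ * (A.submatrix Fin.castSucc Fin.castSucc).det := by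
  have h1 : A.adjugate.mulVec (A.mulVec x) (Fin.last m) = A.det * x (Fin.last m) := by
    rw [Matrix.mulVec_mulVec, Matrix.adjugate_mul, Matrix.smul_mulVec, Matrix.one_mulVec]
    rfl
  rw [← h1, h, Matrix.mulVec_single]
  simp [Matrix.adjugate_fin_succ_eq_det_submatrix, Fin.succAbove_last, ← two_mul, mul_comm]

/-- The tridiagonal matrix with `a` on the diagonal and `1` next to it. -/
def pathMatrix (n : ℕ) (a : ℤ) : Matrix (Fin n) (Fin n) ℚ :=
  Matrix.of fun i j =>
    if i = j then (a : ℚ) else if (i : ℕ) + 1 = j ∨ (j : ℕ) + 1 = i then 1 else 0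

/-- `(-1)^k g_k`, a solution of `s_{k+2} + a s_{k+1} + s_k = 0`. -/
def altSeq (a : ℤ) (k : ℕ) : ℚ := (-1) ^ k * (gSeq a k : ℚ)

theorem altSeq_add_two (a : ℤ) (k : ℕ) :
    altSeq a (k + 2) = -(a * altSeq a (k + 1)) - altSeq a k := by
  simp only [altSeq, gSeq_add_two]
  push_cast
  ring

theorem sum_fin_ite_eq_val {n : ℕ} (k : ℕ) (f : ℕ → ℚ) :
    ∑ j : Fin n, (if (j : ℕ) = k then f j else 0) = if k < n then f k else 0 := by
  rw [Fin.sum_univ_eq_sum_range (fun j => if j = k then f j else 0)]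
  simp [Finset.sum_ite_eq']

theorem pathMatrix_mulVec {n : ℕ} (a : ℤ) (f : ℕ → ℚ) (i : Fin n) :
    (pathMatrix n a).mulVec (fun j => f j) i
      = a * f i + (if (i : ℕ) + 1 < n then f (i + 1) else 0)
        + (if 0 < (i : ℕ) then f (i - 1) else 0) := by
  have h : ∀ j : Fin n, pathMatrix n a i j * f j
      = (if (j : ℕ) = i then a * f j else 0) + (if (j : ℕ) = i + 1 then f j else 0)
        + (if 0 < (i : ℕ) then if (j : ℕ) = i - 1 then f j else 0 else 0) := by
    intro j
    simp only [pathMatrix, Matrix.of_apply, Fin.ext_iff]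
    split_ifs <;> first | omega | simp
  simp only [Matrix.mulVec, dotProduct, h, Finset.sum_add_distrib]
  rw [sum_fin_ite_eq_val _ fun j => a * f j, sum_fin_ite_eq_val _ f, if_pos i.2]
  split_ifs with h1 h2 <;> first | rw [sum_fin_ite_eq_val _ f, if_pos (by omega)] | simp

theorem det_pathMatrix {a : ℤ} (ha : 2 < a) (n : ℕ) :
    (pathMatrix n a).det = (gSeq a (n + 1) : ℚ) := by
  induction n with
  | zero => simp [gSeq]
  | succ n ih =>
    have h := det_mul_last_of_mulVec_eq_single (pathMatrix (n + 1) a)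
      -- The recurrence kills every row but the last, which lacks the neighbour `s_{n+2}`; the first
      -- row works because `s_0 = 0`.
      (fun j => altSeq a (j + 1)) (-altSeq a (n + 2)) (by
        ext i
        rw [pathMatrix_mulVec a (fun j => altSeq a (j + 1)) i, Pi.single_apply]
        obtain ⟨i, hi⟩ := i
        simp only [Fin.ext_iff, Fin.val_last]
        rcases i with _ | i
        · have := altSeq_add_two a 0
          rcases n with _ | n
          · simp_all [altSeq, gSeq]
          · simp_all [altSeq, gSeq]
        · have := altSeq_add_two a (i + 1)
          by_cases hin : i + 1 = n
          · subst hin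
            simp at *
            linarith
          · have : i + 1 + 1 < n + 1 := by omega
            simp [hin, this] at *
            linarith)
    have hs : (pathMatrix (n + 1) a).submatrix Fin.castSucc Fin.castSucc = pathMatrix n a := by
      ext i j
      simp [pathMatrix]
    have hg : (gSeq a (n + 1) : ℚ) ≠ 0 := by
      exact_mod_cast (gSeq_pos ha (Nat.le_add_left 1 n)).ne'
    rw [hs, ih] at h
    simp only [altSeq, Fin.val_last] at h
    apply mul_right_cancel₀ hg
    apply mul_left_cancel₀ (pow_ne_zero (n + 1) (by norm_num : (-1 : ℚ) ≠ 0))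
    linear_combination h

theorem leadingMinor_cycleMatrix {n : ℕ} {a : ℤ} (ha : 2 < a) {i : ℕ} (hi : i < n) :
    leadingMinor (cycleMatrix n a) i hi.le = (gSeq a (i + 1) : ℚ) := by
  rw [← det_pathMatrix ha, leadingMinor]
  congr 1
  ext ⟨j, hj⟩ ⟨k, hk⟩
  simp only [cycleMatrix, pathMatrix, Matrix.submatrix_apply, Matrix.of_apply, Fin.ext_iff,
    Fin.castLE_mk]
  split_ifs <;> first | rfl | omega

theorem cycleMatrix_mulVec {n : ℕ} (hn : 3 ≤ n) (a : ℤ) (f : ℕ → ℚ) (i : Fin n) :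
    (cycleMatrix n a).mulVec (fun j => f j) i
      = a * f i + f (if (i : ℕ) + 1 < n then (i : ℕ) + 1 else 0)
        + f (if 0 < (i : ℕ) then (i : ℕ) - 1 else n - 1) := by
  have h1 : (if (i : ℕ) + 1 < n then (i : ℕ) + 1 else 0) < n := by split_ifs <;> omega
  have h2 : (if 0 < (i : ℕ) then (i : ℕ) - 1 else n - 1) < n := by split_ifs <;> omega
  have h : ∀ j : Fin n, cycleMatrix n a i j * f j
      = (if (j : ℕ) = i then a * f j else 0)
        + (if (j : ℕ) = (if (i : ℕ) + 1 < n then (i : ℕ) + 1 else 0) then f j else 0)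
        + (if (j : ℕ) = (if 0 < (i : ℕ) then (i : ℕ) - 1 else n - 1) then f j else 0) := by
    intro j
    simp only [cycleMatrix, Matrix.of_apply, Fin.ext_iff]
    split_ifs <;> first | omega | simp
  simp only [Matrix.mulVec, dotProduct, h, Finset.sum_add_distrib]
  rw [sum_fin_ite_eq_val _ fun j => a * f j, sum_fin_ite_eq_val _ f, sum_fin_ite_eq_val _ f,
    if_pos i.2, if_pos h1, if_pos h2]

theorem det_cycleMatrix {a : ℤ} (ha : 2 < a) {n : ℕ} (hn : 1 ≤ n) :
    (cycleMatrix (n + 1) a).det = (cycleDet a n : ℚ) := by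
  -- In size 2 the two cyclic neighbours coincide, so this case is computed directly.
  obtain rfl | hn := hn.eq_or_lt
  · rw [Matrix.det_fin_two]
    simp [cycleMatrix, cycleDet, gSeq]
    ring
  have h := det_mul_last_of_mulVec_eq_single (cycleMatrix (n + 1) a)
    -- The path solution plus its cyclic reflection: the reflected terms cancel the wrap-around
    -- entry `s_{n+1}` in row `0`, so only the last row survives.
    (fun j => altSeq a (j + 1) + altSeq a (n - j))
    (a * altSeq a (n + 1) + 2 * altSeq a n - 2) (by
      ext i
      rw [cycleMatrix_mulVec (by omega) a (fun j => altSeq a (j + 1) + altSeq a (n - j)) i,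
        Pi.single_apply]
      obtain ⟨i, hi⟩ := i
      have s0 : altSeq a 0 = 0 := by simp [altSeq, gSeq]
      have s1 : altSeq a 1 = -1 := by simp [altSeq, gSeq]
      simp only [Fin.ext_iff, Fin.val_last]
      rcases i with _ | i
      · obtain ⟨m, rfl⟩ := Nat.exists_eq_add_of_le' hn
        have e1 := altSeq_add_two a 0
        have e2 := altSeq_add_two a (m + 1)
        simp [s0] at *
        linarith
      · by_cases hin : i + 1 = n
        · subst hin
          simp [s0, s1]
          ring
        · obtain ⟨m, rfl⟩ : ∃ m, n = i + m + 2 := ⟨n - i - 2, by omega⟩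
          have e1 := altSeq_add_two a (i + 1)
          have e2 := altSeq_add_two a m
          have n1 : i + m + 2 - (i + 1) = m + 1 := by omega
          have n2 : i + m + 2 - (i + 1 + 1) = m := by omega
          have n3 : i + m + 2 - i = m + 2 := by omega
          have n4 : i + 1 + 1 < i + m + 2 + 1 := by omega
          rw [if_neg hin, if_pos n4, if_pos (by omega)]
          simp only [Nat.add_sub_cancel, n1, n2, n3]
          linarith)
  have hs : ((cycleMatrix (n + 1) a).submatrix Fin.castSucc Fin.castSucc).det = gSeq a (n + 1) :=
    leadingMinor_cycleMatrix ha (Nat.lt_succ_self n)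
  have hg : (gSeq a (n + 1) : ℚ) ≠ 0 := by
    exact_mod_cast (gSeq_pos ha (Nat.le_add_left 1 n)).ne'
  rw [hs] at h
  have hg0 : gSeq a 0 = 0 := rfl
  simp only [altSeq, Fin.val_last, Nat.sub_self, hg0, Int.cast_zero, mul_zero, add_zero] at h
  have h2 : ((-1 : ℚ) ^ n) ^ 2 = 1 := by rw [← pow_mul, mul_comm, pow_mul]; norm_num
  apply mul_right_cancel₀ hg
  rw [cycleDet]
  push_cast
  rw [pow_succ] at h
  linear_combination (-(-1 : ℚ) ^ n) * h
    + (-(cycleMatrix (n + 1) a).det + a * (gSeq a (n + 1) : ℚ) - 2 * gSeq a n) *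
      (gSeq a (n + 1) : ℚ) * h2

/-! ### The Hasse-Minkowski invariant of `B_n(a)` -/

theorem mainTheorem8 (n : ℕ) (a : ℤ) (ha : 2 < a) (hn : 2 ≤ n) (v : RatPlace) :
    IsNondegenerateMatrix (cycleMatrix n a) ∧
      hasseMinkowski v (cycleMatrix n a)
        = hilbertSymbol v (-((a + 2) * (a - 2) ^ (n + 1))) (-gSeq a n)
          * ∏ i ∈ Finset.Icc 2 n, hilbertSymbol v (-gSeq a i) (gSeq a (i - 1)) := by
  obtain ⟨m, rfl⟩ := Nat.exists_eq_add_of_le' hn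
  have hdet : (cycleMatrix (m + 2) a).det = (cycleDet a (m + 1) : ℚ) :=
    det_cycleMatrix ha (Nat.le_add_left 1 m)
  have hlast : ∀ h, leadingMinor (cycleMatrix (m + 2) a) (m + 2) h = (cycleDet a (m + 1) : ℚ) :=
    fun h => hdet
  have hd := cycleDet_pos ha (m + 1)
  have hg : 0 < gSeq a (m + 2) := gSeq_pos ha (by omega)
  constructor
  · intro i hi h1
    rcases hi.eq_or_lt with rfl | hlt
    · rw [hlast]
      exact_mod_cast hd.ne'
    · rw [leadingMinor_cycleMatrix ha hlt]
      exact_mod_cast (gSeq_pos ha (Nat.le_add_left 1 i)).ne'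
  · have hbd : hilbertSymbol v (-1) (-cycleDet a (m + 1))
        * hilbertSymbol v (gSeq a (m + 2)) (-cycleDet a (m + 1))
        = hilbertSymbol v (-((a + 2) * (a - 2) ^ (m + 2 + 1))) (-gSeq a (m + 2)) := by
      rw [← hilbertSymbol_mul_left v (by norm_num) hg.ne' (by linarith), neg_one_mul,
        hilbertSymbol_comm, hilbertSymbol_neg_cycleDet ha v _ (by linarith)]
    -- The factor `i = 2` has no counterpart in the invariant; it is trivial since `g_1 = 1` and
    -- `(1,b) = (1,b)^2 = 1`.
    have hone : hilbertSymbol v (-gSeq a 2) (gSeq a 1) = 1 := by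
      have h2 : -gSeq a 2 ≠ 0 := neg_ne_zero.2 (gSeq_pos ha (by norm_num)).ne'
      have := hilbertSymbol_mul_left v (a := 1) (b := 1) one_ne_zero one_ne_zero h2
      rw [mul_one, hilbertSymbol_mul_self v one_ne_zero h2] at this
      rw [hilbertSymbol_comm]
      exact this
    have hprod : ∏ i ∈ Finset.Icc 2 (m + 2), hilbertSymbol v (-gSeq a i) (gSeq a (i - 1))
        = ∏ i : Fin m, hilbertSymbol v (gSeq a (i + 2)) (-gSeq a (i + 3)) := by
      rw [Fin.prod_univ_eq_prod_range (fun i => hilbertSymbol v (gSeq a (i + 2)) (-gSeq a (i + 3))),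
        ← Finset.Ico_add_one_right_eq_Icc, Finset.prod_Ico_eq_prod_range,
        show m + 2 + 1 - 2 = m + 1 by omega, Finset.prod_range_succ']
      simp only [Nat.add_zero, Nat.add_one_sub_one, hone, mul_one]
      refine Finset.prod_congr rfl fun i _ => ?_
      rw [hilbertSymbol_comm, show 2 + (i + 1) = i + 3 by ring]
      rfl
    rw [hprod, ← hbd, hasseMinkowski, hdet]
    change _ * ∏ i : Fin (m + 1), _ = _
    rw [Fin.prod_univ_castSucc]
    simp only [Fin.val_last, Fin.val_castSucc, hlast]
    rw [leadingMinor_cycleMatrix ha (show m + 1 < m + 2 by omega), mul_comm (∏ i : Fin m, _),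
      ← mul_assoc]
    congr 1
    · rw [← hilbertSymbolRat_intCast, ← hilbertSymbolRat_intCast]
      push_cast
      rfl
    · refine Finset.prod_congr rfl fun i _ => ?_
      rw [leadingMinor_cycleMatrix ha (show (i : ℕ) + 1 < m + 2 by omega),
        leadingMinor_cycleMatrix ha (show (i : ℕ) + 2 < m + 2 by omega),
        ← hilbertSymbolRat_intCast]
      push_cast
      rfl
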